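/- Let $K$ be a field, let $n\ge 4$ be an even integer, and read all indices modulo $n$. Let $S=K[x_0,\dots,x_{n-1}]$, $R=K[y_0,\dots,y_{n-1}]$ and $T=K[x_0,\dots,x_{n-1},y_0,\dots,y_{n-1}]$. Let $I=I_{n/2}(C_n)\subset S$ be the $\tfrac n2$-path ideal of the $n$-cycle, generated by $u_j=x_jx_{j+1}\cdots x_{j+n/2-1}$, $0\le j\le n-1$. Let $L\subset T$ be the defining ideal of the symmetric algebra of $I$, i.e. the ideal generated by all $\sum_j a_jy_j$ with $a_j\in S$ and $\sum_j a_ju_j=0$; and let $H\subset R$ be the ideal of fiber relations of $I$, i.e. the kernel of the $K$-algebra homomorphism $R\to K[u_0,\dots,u_{n-1}]$, $y_j\mapsto u_j$. Let $<_1$ be the (graded) reverse lexicographic order on $R$ induced by $y_1>y_2>\cdots>y_{n-1}>y_0$, let $<_2$ be an arbitrary monomial order on $S$, and let $<$ be the product order of $<_1$ and $<_2$ on $T$: for monomials $v,v'\in R$ and $w,w'\in S$, one has $vw<v'w'$ if and only if $v<_1v'$, or $v=v'$ and $w<_2w'$. Put $$f_j=x_{\frac n2+j}\,y_j-x_j\,y_{j+1}\quad(1\le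 j\le n-1),$$ $$g_k=y_k\prod_{i=0}^{k-1}x_i-y_0\prod_{i=\frac n2}^{\frac n2+k-1}x_i\quad\left(1\le k\le \tfrac n2-1\right),$$ $$h_l=y_l\,y_{l+\frac n2}-y_0\,y_{\frac n2}\quad\left(1\le l\le \tfrac n2-1\right).$$ **Theorem.** The binomials $f_1,\dots,f_{n-1},\,g_1,\dots,g_{\frac n2-1},\,h_1,\dots,h_{\frac n2-1}$ form a Gröbner basis of the ideal $L+HT$ of $T$ with respect to $<$; that is, they are nonzero elements of $L+HT$ and their leading monomials generate the initial ideal $\operatorname{in}_<(L+HT)$. -/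

import Mathlib

open scoped MonomialOrder

noncomputable section

/-! ### Monomial orders -/

/-- Exponent vectors, to be ordered by the (graded) reverse lexicographic order in which the
variable `i` is greater than the variable `j` when `rk i > rk j`. -/
def DegRevLex {σ : Type*} (_rk : σ ↪ ℕ) : Type _ := σ →₀ ℕ

namespace DegRevLex

variable {σ : Type*} (rk : σ ↪ ℕ)

instance : AddCommMonoid (DegRevLex rk) := inferInstanceAs (AddCommMonoid (σ →₀ ℕ))

/-- Total degree first; then the exponents, from the smallest variable upwards, in the
reverse of the lexicographic comparison. -/
def key (a : DegRevLex rk) : ℕ ×ₗ (Lex (ℕ →₀ ℕ))ᵒᵈ :=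
  toLex (Finsupp.degree (show σ →₀ ℕ from a),
    OrderDual.toDual (toLex (Finsupp.embDomain rk (show σ →₀ ℕ from a))))

theorem key_injective : Function.Injective (key rk) := by
  intro a b h
  have h2 := congrArg (fun p => ofLex (OrderDual.ofDual (ofLex p).2)) h
  exact Finsupp.embDomain_injective rk h2

/-- An exponent vector as an element of `DegRevLex rk`. -/
def of : (σ →₀ ℕ) ≃+ DegRevLex rk := AddEquiv.refl (σ →₀ ℕ)

instance : LinearOrder (DegRevLex rk) := LinearOrder.lift' (key rk) (key_injective rk)

/-- `a < b` iff `a` has smaller total degree, or the degrees agree and, at the smallest variable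
at which the exponents differ, `a` has the larger exponent. -/
theorem lt_iff (a b : σ →₀ ℕ) :
    of rk a < of rk b ↔
      a.degree < b.degree ∨ (a.degree = b.degree ∧
        ∃ i, (∀ j, rk j < rk i → a j = b j) ∧ b i < a i) := by
  change toLex (a.degree, OrderDual.toDual (toLex (Finsupp.embDomain rk a))) <
    toLex (b.degree, OrderDual.toDual (toLex (Finsupp.embDomain rk b))) ↔ _
  rw [Prod.Lex.toLex_lt_toLex]
  refine or_congr Iff.rfl (and_congr Iff.rfl ?_)
  rw [OrderDual.toDual_lt_toDual, Finsupp.Lex.lt_iff]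
  constructor
  · rintro ⟨i, h1, h2⟩
    simp only [ofLex_toLex] at h1 h2
    by_cases hi : i ∈ Set.range rk
    · obtain ⟨i, rfl⟩ := hi
      refine ⟨i, fun j hj => ?_, by simpa using h2⟩
      simpa using (h1 _ hj).symm
    · rw [Finsupp.embDomain_of_notMem_range _ _ _ hi, Finsupp.embDomain_of_notMem_range _ _ _ hi] at h2
      exact absurd h2 (lt_irrefl _)
  · rintro ⟨i, h1, h2⟩
    refine ⟨rk i, fun j hj => ?_, by simpa using h2⟩
    simp only [ofLex_toLex]
    by_cases hj' : j ∈ Set.range rk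
    · obtain ⟨j, rfl⟩ := hj'
      simpa using (h1 _ hj).symm
    · rw [Finsupp.embDomain_of_notMem_range _ _ _ hj', Finsupp.embDomain_of_notMem_range _ _ _ hj']

theorem add_lt_add_right' (a b c : σ →₀ ℕ)
    (h : of rk a < of rk b) :
    of rk (a + c) < of rk (b + c) := by
  rw [lt_iff] at h ⊢
  simpa [map_add] using h

instance : IsOrderedAddMonoid (DegRevLex rk) where
  add_le_add_left a b h c := by
    rcases h.lt_or_eq with h | rfl
    · exact (add_lt_add_right' rk a b c h).le
    · exact le_rfl

theorem le_of_le {a b : σ →₀ ℕ} (h : a ≤ b) :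
    of rk a ≤ of rk b := by
  rcases eq_or_ne a b with rfl | hne
  · exact le_rfl
  · refine le_of_lt ((lt_iff rk a b).2 (Or.inl ?_))
    obtain ⟨c, rfl⟩ := exists_add_of_le h
    have hc : c ≠ 0 := by rintro rfl; simp at hne
    have : c.degree ≠ 0 := fun h0 => hc ((Finsupp.degree_eq_zero_iff c).1 h0)
    rw [map_add]
    omega

instance [Finite σ] : WellFoundedLT (DegRevLex rk) := by
  refine ⟨RelEmbedding.wellFounded_iff_isEmpty.2 ⟨fun f => ?_⟩⟩
  obtain ⟨i, j, hij, hle⟩ := wellQuasiOrdered_le (α := σ →₀ ℕ) (fun k => f k)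
  exact absurd (f.map_rel_iff.2 hij) (not_lt_of_ge (le_of_le rk hle))

end DegRevLex

/-- The (graded) reverse lexicographic monomial order for the order of the variables in which
`i` is greater than `j` when `rk i > rk j`. -/
def degRevLexOrder {σ : Type*} [Finite σ] (rk : σ ↪ ℕ) : MonomialOrder σ where
  syn := DegRevLex rk
  toSyn := DegRevLex.of rk
  toSyn_monotone := fun _ _ h => DegRevLex.le_of_le rk h

theorem degRevLexOrder_lt_iff {σ : Type*} [Finite σ] (rk : σ ↪ ℕ) (a b : σ →₀ ℕ) :
    a ≺[degRevLexOrder rk] b ↔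
      a.degree < b.degree ∨ (a.degree = b.degree ∧
        ∃ i, (∀ j, rk j < rk i → a j = b j) ∧ b i < a i) :=
  DegRevLex.lt_iff rk a b

/-- The product of two monomial orders: first compare the parts in the first set of variables by
`m₁`, and in case of a tie the parts in the second set of variables by `m₂`. -/
def productOrder {α β : Type*} (m₁ : MonomialOrder α) (m₂ : MonomialOrder β) :
    MonomialOrder (α ⊕ β) where
  syn := m₁.syn ×ₗ m₂.syn
  toSyn :=
    { toFun := fun a => toLex (m₁.toSyn (Finsupp.sumFinsuppAddEquivProdFinsupp a).1,
        m₂.toSyn (Finsupp.sumFinsuppAddEquivProdFinsupp a).2)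
      invFun := fun p => Finsupp.sumFinsuppAddEquivProdFinsupp.symm
        (m₁.toSyn.symm (ofLex p).1, m₂.toSyn.symm (ofLex p).2)
      left_inv := fun a => by simp
      right_inv := fun p => by simp
      map_add' := fun a b => by simp only [map_add, Prod.fst_add, Prod.snd_add]; rfl }
  toSyn_monotone := fun a b h => Prod.Lex.toLex_mono
    ⟨m₁.toSyn_monotone fun i => h (Sum.inl i), m₂.toSyn_monotone fun i => h (Sum.inr i)⟩

theorem productOrder_lt_iff {α β : Type*} (m₁ : MonomialOrder α) (m₂ : MonomialOrder β)
    (a b : α ⊕ β →₀ ℕ) :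
    a ≺[productOrder m₁ m₂] b ↔
      (Finsupp.sumFinsuppEquivProdFinsupp a).1 ≺[m₁] (Finsupp.sumFinsuppEquivProdFinsupp b).1 ∨
      ((Finsupp.sumFinsuppEquivProdFinsupp a).1 = (Finsupp.sumFinsuppEquivProdFinsupp b).1 ∧
        (Finsupp.sumFinsuppEquivProdFinsupp a).2 ≺[m₂]
          (Finsupp.sumFinsuppEquivProdFinsupp b).2) := by
  refine (Prod.Lex.toLex_lt_toLex (α := m₁.syn) (β := m₂.syn)).trans
    (or_congr Iff.rfl (and_congr ?_ Iff.rfl))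
  exact m₁.toSyn.injective.eq_iff

/-! ### Gröbner bases -/

/-- The initial ideal of `I`: generated by the leading monomials of the nonzero elements. -/
def initialIdeal {σ K : Type*} [Field K] (m : MonomialOrder σ) (I : Ideal (MvPolynomial σ K)) :
    Ideal (MvPolynomial σ K) :=
  Ideal.span {u | ∃ p ∈ I, p ≠ 0 ∧ u = MvPolynomial.monomial (m.degree p) 1}

/-- `G` is a Gröbner basis of `I` with respect to `m`: a finite set of nonzero elements of `I`
whose leading monomials generate the initial ideal of `I`. -/
def IsGroebnerBasis {σ K : Type*} [Field K] (m : MonomialOrder σ) (G : Set (MvPolynomial σ K))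
    (I : Ideal (MvPolynomial σ K)) : Prop :=
  G.Finite ∧ (∀ p ∈ G, p ∈ I ∧ p ≠ 0) ∧
    Ideal.span {u | ∃ p ∈ G, u = MvPolynomial.monomial (m.degree p) 1} = initialIdeal m I

/-! ### Path ideals of cycles -/

namespace CyclePath

open MvPolynomial

/-- `T = K[x_0, …, x_{n-1}, y_0, …, y_{n-1}]`, indices modulo `n`; the variables `y` form the
first block and the variables `x` the second. -/
abbrev T (K : Type*) [Field K] (n : ℕ) : Type _ := MvPolynomial (ZMod n ⊕ ZMod n) K

variable (K : Type*) [Field K] (n : ℕ)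

/-- The variable `y_j` of `T`. -/
def y (j : ZMod n) : T K n := X (Sum.inl j)

/-- The variable `x_i` of `T`. -/
def x (i : ZMod n) : T K n := X (Sum.inr i)

/-- The generator `u_j = x_j x_{j+1} ⋯ x_{j+t-1}` of `I_t(C_n)` in `S = K[x_0, …, x_{n-1}]`. -/
def pathMonomial (t : ℕ) (j : ZMod n) : MvPolynomial (ZMod n) K :=
  ∏ i ∈ Finset.range t, X (j + (i : ZMod n))

/-- The inclusion `S = K[x_0, …, x_{n-1}] → T`. -/
def inclS : MvPolynomial (ZMod n) K →ₐ[K] T K n := rename Sum.inr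

/-- The inclusion `R = K[y_0, …, y_{n-1}] → T`. -/
def inclR : MvPolynomial (ZMod n) K →ₐ[K] T K n := rename Sum.inl

/-- The defining ideal `L` of the symmetric algebra of `I_t(C_n)`: generated by the linear forms
`∑ a_j y_j` for all relations `∑ a_j u_j = 0` with coefficients in `S`. -/
def symIdeal [NeZero n] (t : ℕ) : Ideal (T K n) :=
  Ideal.span {l | ∃ a : ZMod n → MvPolynomial (ZMod n) K,
    ∑ j, a j * pathMonomial K n t j = 0 ∧ l = ∑ j, inclS K n (a j) * y K n j}

/-- The ideal `H ⊆ R` of fiber relations of `I_t(C_n)`: the kernel of `R → K[u_0, …, u_{n-1}]`,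
`y_j ↦ u_j`. -/
def fiberIdeal (t : ℕ) : Ideal (MvPolynomial (ZMod n) K) :=
  RingHom.ker (aeval (pathMonomial K n t) :
    MvPolynomial (ZMod n) K →ₐ[K] MvPolynomial (ZMod n) K)

/-- `f_j = x_{n/2+j} y_j - x_j y_{j+1}`. -/
def f (j : ℕ) : T K n :=
  x K n ((n / 2 + j : ℕ) : ZMod n) * y K n j - x K n j * y K n ((j + 1 : ℕ) : ZMod n)

/-- `g_k = y_k ∏_{i=0}^{k-1} x_i - y_0 ∏_{i=n/2}^{n/2+k-1} x_i`. -/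
def g (k : ℕ) : T K n :=
  y K n k * ∏ i ∈ Finset.range k, x K n (i : ZMod n) -
    y K n 0 * ∏ i ∈ Finset.range k, x K n ((n / 2 + i : ℕ) : ZMod n)

/-- `h_l = y_l y_{l+n/2} - y_0 y_{n/2}`. -/
def h (l : ℕ) : T K n :=
  y K n l * y K n ((l + n / 2 : ℕ) : ZMod n) - y K n 0 * y K n ((n / 2 : ℕ) : ZMod n)

/-- The ranking `y_1 > y_2 > ⋯ > y_{n-1} > y_0`: the variable `y_j` has rank `n - j` for
`1 ≤ j ≤ n - 1`, and `y_0` has rank `0`. -/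
def yRank [NeZero n] : ZMod n ↪ ℕ where
  toFun j := (-j).val
  inj' _ _ hij := neg_injective (ZMod.val_injective n hij)

end CyclePath

end

open scoped MonomialOrder

noncomputable section

open MvPolynomial in
/-- A finite set of elements of `I` with invertible leading coefficients is a Gröbner basis as soon
as no nonzero element of `I` is fully reduced with respect to it. -/
theorem IsGroebnerBasis.of_reduced_eq_zero {σ K : Type*} [Field K] (m : MonomialOrder σ)
    {G : Set (MvPolynomial σ K)} {I : Ideal (MvPolynomial σ K)} (hfin : G.Finite)
    (hG : ∀ p ∈ G, p ∈ I ∧ p ≠ 0)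
    (hred : ∀ r ∈ I, (∀ v ∈ r.support, ∀ p ∈ G, ¬ m.degree p ≤ v) → r = 0) :
    IsGroebnerBasis m G I := by
  refine ⟨hfin, hG, le_antisymm ?_ ?_⟩
  · refine Ideal.span_mono ?_
    rintro u ⟨p, hp, rfl⟩
    exact ⟨p, (hG p hp).1, (hG p hp).2, rfl⟩
  · refine Ideal.span_le.2 ?_
    rintro u ⟨p, hp, hp0, rfl⟩
    obtain ⟨q, r, hpq, hdeg, hr⟩ := m.div_set (B := G)
      (fun b hb => (m.leadingCoeff_ne_zero_iff.2 (hG b hb).2).isUnit) p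
    have hsum : Finsupp.linearCombination _ (fun b : G => (b : MvPolynomial σ K)) q ∈ I := by
      rw [Finsupp.linearCombination_apply]
      exact Submodule.sum_mem _ fun b _ => I.mul_mem_left _ (hG b b.2).1
    have hr0 : r = 0 := by
      refine hred r ?_ hr
      rw [eq_sub_of_add_eq' hpq.symm]
      exact I.sub_mem hp hsum
    rw [hr0, add_zero, Finsupp.linearCombination_apply] at hpq
    have hc : coeff (m.degree p) p ≠ 0 := m.leadingCoeff_ne_zero_iff.2 hp0
    obtain ⟨b, hb⟩ : ∃ b : G, coeff (m.degree p) ((b : MvPolynomial σ K) * q b) ≠ 0 := by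
      by_contra! hall
      refine hc ?_
      have hcoeff := congrArg (coeff (m.degree p)) hpq
      rw [Finsupp.sum, coeff_sum] at hcoeff
      rw [hcoeff]
      refine Finset.sum_eq_zero fun b _ => ?_
      rw [smul_eq_mul, mul_comm]
      exact hall b
    have hle := m.le_degree (mem_support_iff.2 hb)
    have heq : m.degree p = m.degree ((b : MvPolynomial σ K) * q b) :=
      m.toSyn.injective (le_antisymm hle (hdeg b))
    have hne : (b : MvPolynomial σ K) * q b ≠ 0 := by
      rintro h0
      simp [h0] at hb
    rw [m.degree_mul' hne] at heq
    have : monomial (m.degree p) (1 : K) =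
        monomial (m.degree (q b)) 1 * monomial (m.degree (b : MvPolynomial σ K)) 1 := by
      rw [monomial_mul, one_mul, heq, add_comm]
    rw [SetLike.mem_coe, this]
    exact Ideal.mul_mem_left _ _ (Ideal.subset_span ⟨b, b.2, rfl⟩)

namespace MvPolynomial

theorem aeval_monomial_family {σ τ K : Type*} [CommSemiring K] (e : σ → τ →₀ ℕ) (v : σ →₀ ℕ)
    (c : K) :
    aeval (fun i => monomial (e i) (1 : K)) (monomial v c) =
      monomial (Finsupp.linearCombination ℕ e v) c := by
  rw [aeval_monomial, algebraMap_eq, Finsupp.linearCombination_apply]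
  have : (v.prod fun i k => monomial (e i) (1 : K) ^ k) =
      monomial (v.sum fun i k => k • e i) 1 := by
    simp only [Finsupp.prod, Finsupp.sum, monomial_pow, one_pow]
    rw [monomial_sum_one]
  rw [this, C_mul_monomial, mul_one]

/-- A polynomial in the kernel of a monomial map vanishes if the map separates the monomials of
its support. -/
theorem eq_zero_of_aeval_monomial_family_eq_zero {σ τ K : Type*} [CommSemiring K]
    (e : σ → τ →₀ ℕ) (r : MvPolynomial σ K)
    (hinj : Set.InjOn (Finsupp.linearCombination ℕ e) r.support)
    (hr : aeval (fun i => monomial (e i) (1 : K)) r = 0) : r = 0 := by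
  classical
  by_contra h0
  obtain ⟨v, hv⟩ := support_nonempty.2 h0
  have h1 := congrArg (coeff (Finsupp.linearCombination ℕ e v)) hr
  conv_lhs at h1 => rw [r.as_sum]
  rw [map_sum, coeff_sum, Finset.sum_eq_single v, aeval_monomial_family, coeff_monomial,
    if_pos rfl, coeff_zero] at h1
  · exact mem_support_iff.1 hv h1
  · intro w hw hwv
    rw [aeval_monomial_family, coeff_monomial, if_neg]
    exact fun h => hwv (hinj hw hv h)
  · exact fun h => absurd hv h

theorem degree_binomial {σ K : Type*} [Field K] (m : MonomialOrder σ) {v w : σ →₀ ℕ}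
    (h : w ≺[m] v) : m.degree (monomial v (1 : K) - monomial w 1) = v := by
  classical
  have hd (u : σ →₀ ℕ) : m.degree (monomial u (1 : K)) = u := by
    rw [m.degree_monomial, if_neg one_ne_zero]
  rw [m.degree_sub_of_lt, hd]
  rwa [hd, hd]

theorem binomial_ne_zero {σ K : Type*} [Field K] {v w : σ →₀ ℕ} (h : w ≠ v) :
    monomial v (1 : K) - monomial w 1 ≠ 0 := by
  rw [sub_ne_zero]
  exact fun h' => h ((monomial_left_injective one_ne_zero h').symm)

end MvPolynomial

theorem productOrder_degRevLexOrder_lt {α β : Type*} [Finite α] (rk : α ↪ ℕ)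
    (m₂ : MonomialOrder β) {a b : α →₀ ℕ} (c d : β →₀ ℕ) (hdeg : a.degree = b.degree) (i : α)
    (hlt : ∀ j, rk j < rk i → a j = b j) (hi : b i < a i) :
    Finsupp.sumElim a c ≺[productOrder (degRevLexOrder rk) m₂] Finsupp.sumElim b d := by
  have hfst (u : α →₀ ℕ) (w : β →₀ ℕ) :
      (Finsupp.sumFinsuppEquivProdFinsupp (Finsupp.sumElim u w)).1 = u := by
    ext; rfl
  rw [productOrder_lt_iff, hfst, hfst, degRevLexOrder_lt_iff]
  exact Or.inl (Or.inr ⟨hdeg, i, hlt, hi⟩)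

namespace CyclePath

/-- The conditions on the exponents `a` of the `x_i` and `b` of the `y_j` which say that a monomial
is not divisible by the leading monomial of any `f_j`, `g_k` or `h_l`, where `n = 2m`. -/
structure IsStandard (m : ℕ) (a b : ℕ → ℕ) : Prop where
  f_low : ∀ l, 1 ≤ l → l < m → b l = 0 ∨ a (l + m) = 0
  f_mid : b m = 0 ∨ a 0 = 0
  f_high : ∀ l, 1 ≤ l → l < m → b (l + m) = 0 ∨ a l = 0
  g : ∀ k, 1 ≤ k → k < m → b k = 0 ∨ ∃ i < k, a i = 0
  h : ∀ l, 1 ≤ l → l < m → b l = 0 ∨ b (l + m) = 0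

/-- The equations between two exponent vectors which say that they have the same image in the Rees
algebra, where `n = 2m`. -/
structure SameImage (m : ℕ) (a b a' b' : ℕ → ℕ) : Prop where
  opposite : ∀ i < m, a i + a (i + m) = a' i + a' (i + m)
  step : ∀ l, 1 ≤ l → l < m →
    a l + b l + a' (l - 1) + b' (l + m) = a' l + b' l + a (l - 1) + b (l + m)
  wrap : a 0 + b 0 + a' (m - 1 + m) + b' m = a' 0 + b' 0 + a (m - 1 + m) + b m
  total : b 0 + b m + ∑ l ∈ Finset.Ico 1 m, (b l + b (l + m)) =
    b' 0 + b' m + ∑ l ∈ Finset.Ico 1 m, (b' l + b' (l + m))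

theorem SameImage.symm {m : ℕ} {a b a' b' : ℕ → ℕ} (h : SameImage m a b a' b') :
    SameImage m a' b' a b :=
  ⟨fun i hi => (h.opposite i hi).symm, fun l h1 h2 => (h.step l h1 h2).symm, h.wrap.symm,
    h.total.symm⟩

theorem SameImage.le_and_le {m : ℕ} {a b a' b' : ℕ → ℕ} (hs : IsStandard m a b)
    (hs' : IsStandard m a' b') (he : SameImage m a b a' b') (h0 : a' 0 ≤ a 0) (l : ℕ) (hl : l < m) :
    a' l ≤ a l ∧ (1 ≤ l → a l + a' (l - 1) ≤ a' l + a (l - 1)) := by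
  induction l with
  | zero => exact ⟨h0, fun h => absurd h (by omega)⟩
  | succ l ih =>
    have ih := (ih (by omega)).1
    have h1 := he.step (l + 1) (by omega) hl
    have h2 := he.opposite (l + 1) hl
    have := hs.f_low (l + 1) (by omega) hl
    have := hs.f_high (l + 1) (by omega) hl
    have := hs.h (l + 1) (by omega) hl
    have := hs'.f_low (l + 1) (by omega) hl
    have := hs'.f_high (l + 1) (by omega) hl
    have := hs'.h (l + 1) (by omega) hl
    simp only [Nat.add_sub_cancel] at h1 ⊢
    omega

theorem SameImage.eq_of_le {m : ℕ} (hm : 2 ≤ m) {a b a' b' : ℕ → ℕ} (hs : IsStandard m a b)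
    (hs' : IsStandard m a' b') (he : SameImage m a b a' b') (h0 : a' 0 ≤ a 0) :
    ∀ i < m, a i = a' i ∧ a (i + m) = a' (i + m) ∧ b i = b' i ∧ b (i + m) = b' (i + m) := by
  have hle := he.le_and_le hs hs' h0
  have hpair : ∀ l ∈ Finset.Ico 1 m, b l + b (l + m) ≤ b' l + b' (l + m) := by
    intro l hl
    obtain ⟨h1, h2⟩ := Finset.mem_Ico.1 hl
    have hstep := he.step l h1 h2
    have hl' := (hle l h2).2 h1
    have hg := hs.g l h1 h2
    have := hs.h l h1 h2
    have := hs'.h l h1 h2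
    by_contra! hlt
    obtain ⟨i, hi, hai⟩ := hg.resolve_left (by omega)
    have hmono : ∀ k, i ≤ k → k < m → a k ≤ a' k := by
      intro k hik
      induction k, hik using Nat.le_induction with
      | base => omega
      | succ k _ ih =>
        intro hk
        have h3 := ih (by omega)
        have h4 := (hle (k + 1) hk).2 (by omega)
        simp only [Nat.add_sub_cancel] at h4
        omega
    have h3 := hmono (l - 1) (by omega) (by omega)
    have h4 := hmono l (by omega) h2
    have h5 := (hle l h2).1
    have h6 := (hle (l - 1) (by omega)).1
    omega
  have hsum := Finset.sum_le_sum hpair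
  have hopp := he.opposite (m - 1) (by omega)
  have hlast := (hle (m - 1) (by omega)).1
  have hwrap := he.wrap
  have htot := he.total
  have hmid := hs.f_mid
  have ha0 : a 0 = a' 0 := by omega
  have ha : ∀ i < m, a i = a' i := by
    intro i
    induction i with
    | zero => exact fun _ => ha0
    | succ i ih =>
      intro hi
      have h1 := ih (by omega)
      have h2 := (hle (i + 1) hi).1
      have h3 := (hle (i + 1) hi).2 (by omega)
      simp only [Nat.add_sub_cancel] at h3
      omega
  have hb : ∀ l, 1 ≤ l → l < m → b l = b' l ∧ b (l + m) = b' (l + m) := by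
    intro l h1 h2
    have h3 := he.step l h1 h2
    have h4 := ha l h2
    have h5 := ha (l - 1) (by omega)
    have := hs.h l h1 h2
    have := hs'.h l h1 h2
    omega
  have hsum' : ∑ l ∈ Finset.Ico 1 m, (b l + b (l + m)) =
      ∑ l ∈ Finset.Ico 1 m, (b' l + b' (l + m)) := by
    refine Finset.sum_congr rfl fun l hl => ?_
    obtain ⟨h1, h2⟩ := Finset.mem_Ico.1 hl
    rw [(hb l h1 h2).1, (hb l h1 h2).2]
  intro i hi
  have h1 := he.opposite i hi
  have h2 := ha i hi
  have h3 := ha (m - 1) (by omega)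
  refine ⟨h2, by omega, ?_⟩
  rcases Nat.eq_zero_or_pos i with rfl | hpos
  · rw [zero_add]
    omega
  · exact hb i hpos hi

/-- Two standard monomials with the same image in the Rees algebra agree. -/
theorem SameImage.eq {m : ℕ} (hm : 2 ≤ m) {a b a' b' : ℕ → ℕ} (hs : IsStandard m a b)
    (hs' : IsStandard m a' b') (he : SameImage m a b a' b') :
    ∀ i < m, a i = a' i ∧ a (i + m) = a' (i + m) ∧ b i = b' i ∧ b (i + m) = b' (i + m) := by
  rcases le_total (a' 0) (a 0) with h0 | h0
  · exact he.eq_of_le hm hs hs' h0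
  · intro i hi
    obtain ⟨h1, h2, h3, h4⟩ := he.symm.eq_of_le hm hs' hs h0 i hi
    exact ⟨h1.symm, h2.symm, h3.symm, h4.symm⟩

end CyclePath

@[to_additive]
theorem ZMod.prod_range_natCast {M : Type*} [CommMonoid M] (n : ℕ) [NeZero n] (F : ZMod n → M) :
    ∏ i ∈ Finset.range n, F (i : ZMod n) = ∏ z, F z := by
  refine Finset.prod_bij (fun i _ => (i : ZMod n)) (fun _ _ => Finset.mem_univ _) ?_ ?_
    (fun _ _ => rfl)
  · intro i hi j hj hij
    rw [Finset.mem_range] at hi hj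
    have h := congrArg ZMod.val hij
    rwa [ZMod.val_natCast_of_lt hi, ZMod.val_natCast_of_lt hj] at h
  · intro z _
    exact ⟨z.val, Finset.mem_range.2 z.val_lt, ZMod.natCast_zmod_val z⟩

theorem ZMod.natCast_injOn {n i j : ℕ} (hi : i < n) (hj : j < n)
    (h : (i : ZMod n) = (j : ZMod n)) : i = j := by
  have h := congrArg ZMod.val h
  rwa [ZMod.val_natCast_of_lt hi, ZMod.val_natCast_of_lt hj] at h

namespace CyclePath

open MvPolynomial

variable (K : Type*) [Field K] (n : ℕ)

/-! ### Membership of the binomials in the ideal -/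

theorem inclS_mul_y_sub_mem_symIdeal [NeZero n] (t : ℕ) (p q : MvPolynomial (ZMod n) K)
    (j k : ZMod n) (h : p * pathMonomial K n t j = q * pathMonomial K n t k) :
    inclS K n p * y K n j - inclS K n q * y K n k ∈ symIdeal K n t := by
  refine Ideal.subset_span ⟨Pi.single j p - Pi.single k q, ?_, ?_⟩
  · simp [sub_mul, Finset.sum_sub_distrib, Pi.single_apply, ite_mul, h]
  · simp [sub_mul, Finset.sum_sub_distrib, Pi.single_apply, apply_ite (inclS K n), ite_mul]

theorem f_mem [NeZero n] (j : ℕ) : f K n j ∈ symIdeal K n (n / 2) := by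
  have key : X ((n / 2 + j : ℕ) : ZMod n) * pathMonomial K n (n / 2) j =
      X (j : ZMod n) * pathMonomial K n (n / 2) ((j + 1 : ℕ) : ZMod n) := by
    have h1 := Finset.prod_range_succ
      (fun i : ℕ => (X ((j : ZMod n) + (i : ZMod n)) : MvPolynomial (ZMod n) K)) (n / 2)
    rw [Finset.prod_range_succ'] at h1
    simp only [pathMonomial]
    push_cast at h1 ⊢
    rw [mul_comm (X _), mul_comm (X _), add_comm ((n / 2 : ℕ) : ZMod n), ← h1, add_zero]
    congr 1
    exact Finset.prod_congr rfl fun i _ => by rw [add_right_comm, add_assoc]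
  simpa [f, inclS, x] using inclS_mul_y_sub_mem_symIdeal K n (n / 2) _ _ _ _ key

theorem g_mem [NeZero n] (k : ℕ) : g K n k ∈ symIdeal K n (n / 2) := by
  have key : (∏ i ∈ Finset.range k, X (i : ZMod n)) * pathMonomial K n (n / 2) k =
      (∏ i ∈ Finset.range k, X ((n / 2 + i : ℕ) : ZMod n)) * pathMonomial K n (n / 2) 0 := by
    have h1 := Finset.prod_range_add (fun i : ℕ => (X (i : ZMod n) : MvPolynomial (ZMod n) K))
      k (n / 2)
    rw [add_comm k, Finset.prod_range_add] at h1
    simp only [pathMonomial, zero_add]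
    rw [mul_comm _ (∏ i ∈ Finset.range (n / 2), X (i : ZMod n)), h1]
    push_cast
    rfl
  have := inclS_mul_y_sub_mem_symIdeal K n (n / 2) _ _ _ _ key
  rw [map_prod, map_prod, mul_comm _ (y K n _), mul_comm _ (y K n _)] at this
  simpa only [inclS, rename_X, g, x] using this

theorem pathMonomial_mul_opposite [NeZero n] {m : ℕ} (hn : n = m + m) (z : ZMod n) :
    pathMonomial K n m z * pathMonomial K n m (z + m) = ∏ i, X i := by
  have h1 := Finset.prod_range_add
    (fun i : ℕ => (X (z + (i : ZMod n)) : MvPolynomial (ZMod n) K)) m m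
  rw [← hn, ZMod.prod_range_natCast n fun i => (X (z + i) : MvPolynomial (ZMod n) K),
    Fintype.prod_equiv (Equiv.addLeft z) (fun i => (X (z + i) : MvPolynomial (ZMod n) K)) X
      fun _ => rfl] at h1
  rw [h1]
  simp only [pathMonomial]
  push_cast
  simp only [add_assoc]

theorem h_mem [NeZero n] (hn : Even n) (l : ℕ) :
    h K n l ∈ (fiberIdeal K n (n / 2)).map (inclR K n) := by
  have hn' : n = n / 2 + n / 2 := by obtain ⟨m, rfl⟩ := hn; omega
  have key : (X (l : ZMod n) * X ((l + n / 2 : ℕ) : ZMod n) - X 0 * X ((n / 2 : ℕ) : ZMod n) :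
      MvPolynomial (ZMod n) K) ∈ fiberIdeal K n (n / 2) := by
    have h1 := pathMonomial_mul_opposite K n hn' l
    have h2 := pathMonomial_mul_opposite K n hn' 0
    rw [zero_add] at h2
    rw [fiberIdeal, RingHom.mem_ker]
    simp only [map_sub, map_mul, aeval_X, Nat.cast_add]
    rw [h1, h2, sub_self]
  simpa [inclR, h, y] using Ideal.mem_map_of_mem (inclR K n) key

/-! ### The map to the Rees algebra -/

/-- The exponents of the images of the variables under `x_i ↦ x_i`, `y_j ↦ u_j s ^ t`, where `s` is
the variable `none`. -/
def reesExponent (t : ℕ) : ZMod n ⊕ ZMod n → Option (ZMod n) →₀ ℕ :=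
  Sum.elim
    (fun j => ∑ r ∈ Finset.range t, Finsupp.single (some (j + (r : ZMod n))) 1 +
      Finsupp.single none t)
    (fun i => Finsupp.single (some i) 1)

/-- The map `x_i ↦ x_i`, `y_j ↦ u_j s ^ t`, whose image is a copy of the Rees algebra. -/
def toRees (t : ℕ) : T K n →ₐ[K] MvPolynomial (Option (ZMod n)) K :=
  aeval fun v => monomial (reesExponent n t v) 1

theorem toRees_x (t : ℕ) (i : ZMod n) : toRees K n t (x K n i) = X (some i) := by
  rw [toRees, x, aeval_X]
  rfl

theorem toRees_y (t : ℕ) (j : ZMod n) :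
    toRees K n t (y K n j) = rename some (pathMonomial K n t j) * X none ^ t := by
  simp only [toRees, y, aeval_X, reesExponent, Sum.elim_inl, pathMonomial, map_prod, rename_X]
  rw [← mul_one (1 : K), ← monomial_mul, monomial_sum_one, X_pow_eq_monomial]
  rfl

theorem toRees_inclS (t : ℕ) (p : MvPolynomial (ZMod n) K) :
    toRees K n t (inclS K n p) = rename some p := by
  have : (toRees K n t).comp (inclS K n) = rename some := by
    ext i : 1
    simpa [inclS, x] using toRees_x K n t i
  exact DFunLike.congr_fun this p

theorem toRees_inclR (t : ℕ) (p : MvPolynomial (ZMod n) K) :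
    toRees K n t (inclR K n p) =
      aeval (fun i => (X (some i) * X none : MvPolynomial (Option (ZMod n)) K))
        (aeval (pathMonomial K n t) p) := by
  have : (toRees K n t).comp (inclR K n) =
      (aeval fun i => (X (some i) * X none : MvPolynomial (Option (ZMod n)) K)).comp
        (aeval (pathMonomial K n t)) := by
    ext j : 1
    have := toRees_y K n t j
    simp only [y] at this
    simp [inclR, this, pathMonomial, Finset.prod_mul_distrib]
  exact DFunLike.congr_fun this p

theorem toRees_eq_zero [NeZero n] (t : ℕ) {p : T K n}
    (hp : p ∈ symIdeal K n t ⊔ (fiberIdeal K n t).map (inclR K n)) : toRees K n t p = 0 := by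
  suffices h : symIdeal K n t ⊔ (fiberIdeal K n t).map (inclR K n) ≤
      RingHom.ker (toRees K n t) from h hp
  refine sup_le (Ideal.span_le.2 ?_) (Ideal.map_le_iff_le_comap.2 ?_)
  · rintro l ⟨a, ha, rfl⟩
    rw [SetLike.mem_coe, RingHom.mem_ker, map_sum]
    simp only [map_mul, toRees_inclS, toRees_y, ← mul_assoc]
    rw [← Finset.sum_mul]
    simp only [← map_mul]
    rw [← map_sum, ha, map_zero, zero_mul]
  · intro q hq
    rw [fiberIdeal, RingHom.mem_ker] at hq
    rw [Ideal.mem_comap, RingHom.mem_ker, toRees_inclR, hq, map_zero]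

variable {n}

theorem linearCombination_reesExponent_none [NeZero n] (t : ℕ) (v : ZMod n ⊕ ZMod n →₀ ℕ) :
    Finsupp.linearCombination ℕ (reesExponent n t) v none = t * ∑ j, v (Sum.inl j) := by
  rw [Finsupp.linearCombination_apply, Finsupp.sum_fintype _ _ (by simp), Fintype.sum_sum_type]
  simp [reesExponent, Finset.mul_sum, mul_comm]

theorem linearCombination_reesExponent_some [NeZero n] (t : ℕ) (v : ZMod n ⊕ ZMod n →₀ ℕ)
    (i : ZMod n) :
    Finsupp.linearCombination ℕ (reesExponent n t) v (some i) =
      v (Sum.inr i) + ∑ r ∈ Finset.range t, v (Sum.inl (i - r)) := by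
  classical
  rw [Finsupp.linearCombination_apply, Finsupp.sum_fintype _ _ (by simp), Fintype.sum_sum_type]
  simp only [reesExponent, Sum.elim_inl, Sum.elim_inr, Finsupp.add_apply, Finsupp.finsetSum_apply,
    Finsupp.smul_apply, Finsupp.single_apply, Option.some_inj, smul_eq_mul, Finset.mul_sum,
    mul_ite, mul_one, mul_zero, reduceCtorEq, if_false, add_zero, Finset.sum_ite_eq',
    Finset.mem_univ, if_true, ← eq_sub_iff_add_eq]
  rw [Finset.sum_comm, add_comm]
  simp

end CyclePath

namespace CyclePath

open MvPolynomial

variable {n : ℕ}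

/-! ### Separation of standard monomials -/

theorem window_sum_shift {m : ℕ} (hn : n = m + m) (F : ZMod n → ℕ) (z : ZMod n) :
    ∑ r ∈ Finset.range m, F (z + 1 - (r : ZMod n)) + F (z + 1 + m) =
      ∑ r ∈ Finset.range m, F (z - (r : ZMod n)) + F (z + 1) := by
  have hm : (m : ZMod n) + m = 0 := by rw [← Nat.cast_add, ← hn, ZMod.natCast_self]
  have h1 := Finset.sum_range_succ (fun r : ℕ => F (z + 1 - (r : ZMod n))) m
  rw [Finset.sum_range_succ', sub_eq_add_neg _ (m : ZMod n), neg_eq_of_add_eq_zero_left hm] at h1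
  rw [← h1]
  congr 1
  · exact Finset.sum_congr rfl fun r _ => by push_cast; ring_nf
  · simp

theorem window_sum_add_opposite [NeZero n] {m : ℕ} (hn : n = m + m) (F : ZMod n → ℕ)
    (z : ZMod n) :
    ∑ r ∈ Finset.range m, F (z - (r : ZMod n)) + ∑ r ∈ Finset.range m, F (z + m - (r : ZMod n)) =
      ∑ j, F j := by
  have hm : (m : ZMod n) + m = 0 := by rw [← Nat.cast_add, ← hn, ZMod.natCast_self]
  have h1 := Finset.sum_range_add (fun r : ℕ => F (z - (r : ZMod n))) m m
  rw [← hn, ZMod.sum_range_natCast n fun r => F (z - r),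
    Fintype.sum_equiv (Equiv.subLeft z) (fun r => F (z - r)) F fun _ => rfl] at h1
  rw [h1]
  congr 1
  refine Finset.sum_congr rfl fun r _ => congrArg F ?_
  push_cast
  linear_combination hm

theorem sum_univ_eq_sum_pairs [NeZero n] {m : ℕ} (hm : 1 ≤ m) (hn : n = m + m)
    (F : ZMod n → ℕ) :
    ∑ j, F j = F (0 : ℕ) + F m +
      ∑ l ∈ Finset.Ico 1 m, (F (l : ZMod n) + F ((l + m : ℕ) : ZMod n)) := by
  rw [← ZMod.sum_range_natCast n F, congrArg Finset.range hn, Finset.sum_range_add, ← Finset.sum_add_distrib,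
    Finset.range_eq_Ico, Finset.sum_eq_sum_Ico_succ_bot (by omega)]
  simp [add_comm]

theorem sameImage_of_linearCombination_eq [NeZero n] {m : ℕ} (hm : 1 ≤ m) (hn : n = m + m)
    {v w : ZMod n ⊕ ZMod n →₀ ℕ}
    (h : Finsupp.linearCombination ℕ (reesExponent n m) v =
      Finsupp.linearCombination ℕ (reesExponent n m) w) :
    SameImage m (fun i => v (Sum.inr (i : ZMod n))) (fun j => v (Sum.inl (j : ZMod n)))
      (fun i => w (Sum.inr (i : ZMod n))) (fun j => w (Sum.inl (j : ZMod n))) := by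
  have hm0 : (m : ZMod n) + m = 0 := by rw [← Nat.cast_add, ← hn, ZMod.natCast_self]
  have htot : ∑ j, v (Sum.inl j) = ∑ j, w (Sum.inl j) := by
    have h1 := DFunLike.congr_fun h none
    rw [linearCombination_reesExponent_none, linearCombination_reesExponent_none] at h1
    exact Nat.eq_of_mul_eq_mul_left hm h1
  have hcoord (z : ZMod n) := DFunLike.congr_fun h (some z)
  simp only [linearCombination_reesExponent_some] at hcoord
  have hstep (z : ZMod n) : v (Sum.inr (z + 1)) + v (Sum.inl (z + 1)) + w (Sum.inr z) +
      w (Sum.inl (z + 1 + m)) = w (Sum.inr (z + 1)) + w (Sum.inl (z + 1)) + v (Sum.inr z) +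
      v (Sum.inl (z + 1 + m)) := by
    have h1 := hcoord z
    have h2 := hcoord (z + 1)
    have h3 := window_sum_shift hn (fun j => v (Sum.inl j)) z
    have h4 := window_sum_shift hn (fun j => w (Sum.inl j)) z
    omega
  refine ⟨?_, ?_, ?_, ?_⟩
  · intro i _
    have h1 := hcoord i
    have h2 := hcoord (i + m)
    have h3 := window_sum_add_opposite hn (fun j => v (Sum.inl j)) i
    have h4 := window_sum_add_opposite hn (fun j => w (Sum.inl j)) i
    push_cast
    omega
  · intro l hl _
    obtain ⟨k, rfl⟩ := Nat.exists_eq_add_of_le' hl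
    simpa using hstep k
  · have h1 := hstep ((m - 1 + m : ℕ) : ZMod n)
    have h2 : ((m - 1 + m : ℕ) : ZMod n) + 1 = 0 := by
      rw [← Nat.cast_succ, show (m - 1 + m).succ = n by omega, ZMod.natCast_self]
    rw [h2, zero_add] at h1
    simpa using h1
  · simpa only [sum_univ_eq_sum_pairs hm hn] using htot

theorem eq_of_isStandard [NeZero n] {m : ℕ} (hm : 2 ≤ m) (hn : n = m + m)
    {v w : ZMod n ⊕ ZMod n →₀ ℕ}
    (hv : IsStandard m (fun i => v (Sum.inr (i : ZMod n))) fun j => v (Sum.inl (j : ZMod n)))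
    (hw : IsStandard m (fun i => w (Sum.inr (i : ZMod n))) fun j => w (Sum.inl (j : ZMod n)))
    (h : Finsupp.linearCombination ℕ (reesExponent n m) v =
      Finsupp.linearCombination ℕ (reesExponent n m) w) : v = w := by
  have key := (sameImage_of_linearCombination_eq (by omega) hn h).eq hm hv hw
  have hall : ∀ i < n, v (Sum.inr (i : ZMod n)) = w (Sum.inr (i : ZMod n)) ∧
      v (Sum.inl (i : ZMod n)) = w (Sum.inl (i : ZMod n)) := by
    intro i hi
    rcases lt_or_ge i m with h1 | h1
    · exact ⟨(key i h1).1, (key i h1).2.2.1⟩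
    · obtain ⟨k, rfl⟩ := Nat.exists_eq_add_of_le' h1
      have hk := key k (by omega)
      exact ⟨hk.2.1, hk.2.2.2⟩
  ext z
  rcases z with z | z
  · simpa using (hall z.val z.val_lt).2
  · simpa using (hall z.val z.val_lt).1

/-! ### Leading monomials -/

variable (K : Type*) [Field K]

theorem monomial_sumElim (a b : ZMod n →₀ ℕ) :
    (monomial (Finsupp.sumElim a b) 1 : T K n) =
      inclR K n (monomial a 1) * inclS K n (monomial b 1) := by
  have : Finsupp.sumElim a b = a.mapDomain Sum.inl + b.mapDomain Sum.inr := by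
    ext z
    rcases z with z | z
    · rw [Finsupp.add_apply, Finsupp.mapDomain_apply Sum.inl_injective,
        Finsupp.mapDomain_of_notMem_range _ _ (by simp)]
      rfl
    · rw [Finsupp.add_apply, Finsupp.mapDomain_apply Sum.inr_injective,
        Finsupp.mapDomain_of_notMem_range _ _ (by simp), zero_add]
      rfl
  rw [inclR, inclS, rename_monomial, rename_monomial, monomial_mul, one_mul, this]

theorem f_eq (j : ℕ) : f K n j =
    monomial (Finsupp.sumElim (Finsupp.single (j : ZMod n) 1)
      (Finsupp.single ((n / 2 + j : ℕ) : ZMod n) 1)) 1 -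
    monomial (Finsupp.sumElim (Finsupp.single ((j + 1 : ℕ) : ZMod n) 1)
      (Finsupp.single (j : ZMod n) 1)) 1 := by
  rw [monomial_sumElim, monomial_sumElim]
  change _ = inclR K n (X _) * inclS K n (X _) - inclR K n (X _) * inclS K n (X _)
  simp only [f, x, y, inclR, inclS, rename_X]
  ring

theorem g_eq (k : ℕ) : g K n k =
    monomial (Finsupp.sumElim (Finsupp.single (k : ZMod n) 1)
      (∑ i ∈ Finset.range k, Finsupp.single (i : ZMod n) 1)) 1 -
    monomial (Finsupp.sumElim (Finsupp.single (0 : ZMod n) 1)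
      (∑ i ∈ Finset.range k, Finsupp.single ((n / 2 + i : ℕ) : ZMod n) 1)) 1 := by
  rw [monomial_sumElim, monomial_sumElim, monomial_sum_one, monomial_sum_one]
  change _ = inclR K n (X _) * inclS K n (∏ i ∈ _, X _) - inclR K n (X _) * inclS K n (∏ i ∈ _, X _)
  simp only [g, x, y, inclR, inclS, rename_X, map_prod]

theorem h_eq (l : ℕ) : h K n l =
    monomial (Finsupp.sumElim (Finsupp.single (l : ZMod n) 1 +
      Finsupp.single ((l + n / 2 : ℕ) : ZMod n) 1) 0) 1 -
    monomial (Finsupp.sumElim (Finsupp.single (0 : ZMod n) 1 +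
      Finsupp.single ((n / 2 : ℕ) : ZMod n) 1) 0) 1 := by
  rw [monomial_sumElim, monomial_sumElim, ← one_mul (1 : K), ← monomial_mul, ← monomial_mul,
    one_mul]
  change _ = inclR K n (X _ * X _) * inclS K n 1 - inclR K n (X _ * X _) * inclS K n 1
  simp only [h, y, inclR, rename_X, map_mul, map_one, mul_one]

theorem yRank_natCast [NeZero n] {j : ℕ} (h1 : 1 ≤ j) (h2 : j ≤ n) :
    yRank n (j : ZMod n) = n - j := by
  change (-(j : ZMod n)).val = n - j
  have : -(j : ZMod n) = ((n - j : ℕ) : ZMod n) := by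
    rw [Nat.cast_sub h2, ZMod.natCast_self, zero_sub]
  rw [this, ZMod.val_natCast_of_lt (by omega)]

theorem yRank_zero [NeZero n] : yRank n 0 = 0 := by
  change (-(0 : ZMod n)).val = 0
  rw [neg_zero, ZMod.val_zero]

variable (m₂ : MonomialOrder (ZMod n))

theorem natCast_ne_natCast {i j : ℕ} (hi : i < n) (hj : j < n) (hij : i ≠ j) :
    (i : ZMod n) ≠ (j : ZMod n) := fun h => hij (ZMod.natCast_injOn hi hj h)

theorem natCast_ne_zero' {i : ℕ} (h1 : 1 ≤ i) (hi : i < n) : (i : ZMod n) ≠ 0 := by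
  simpa using natCast_ne_natCast hi (j := 0) (by omega) (by omega)

theorem f_lt [NeZero n] {j : ℕ} (h1 : 1 ≤ j) (h2 : j < n) (c d : ZMod n →₀ ℕ) :
    Finsupp.sumElim (Finsupp.single ((j + 1 : ℕ) : ZMod n) 1) c
      ≺[productOrder (degRevLexOrder (yRank n)) m₂]
      Finsupp.sumElim (Finsupp.single (j : ZMod n) 1) d := by
  have hrk : yRank n ((j + 1 : ℕ) : ZMod n) < yRank n (j : ZMod n) := by
    rw [yRank_natCast (by omega) h2, yRank_natCast h1 (by omega)]
    omega
  refine productOrder_degRevLexOrder_lt _ _ _ _ (by simp) ((j + 1 : ℕ) : ZMod n) ?_ ?_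
  · intro i hi
    rw [Finsupp.single_eq_of_ne, Finsupp.single_eq_of_ne]
    · rintro rfl
      exact lt_asymm hi hrk
    · rintro rfl
      exact lt_irrefl _ hi
  · rw [Finsupp.single_eq_same, Finsupp.single_eq_of_ne]
    · exact one_pos
    · intro h
      rw [h] at hrk
      exact lt_irrefl _ hrk

theorem lt_of_apply_zero [NeZero n] {a b : ZMod n →₀ ℕ} (hdeg : a.degree = b.degree)
    (h0 : b 0 < a 0) (c d : ZMod n →₀ ℕ) :
    Finsupp.sumElim a c ≺[productOrder (degRevLexOrder (yRank n)) m₂] Finsupp.sumElim b d :=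
  productOrder_degRevLexOrder_lt _ _ _ _ hdeg 0
    (fun j hj => absurd hj (by rw [yRank_zero]; exact Nat.not_lt_zero _)) h0

theorem g_lt [NeZero n] {k : ℕ} (h1 : 1 ≤ k) (h2 : k < n) (c d : ZMod n →₀ ℕ) :
    Finsupp.sumElim (Finsupp.single (0 : ZMod n) 1) c
      ≺[productOrder (degRevLexOrder (yRank n)) m₂]
      Finsupp.sumElim (Finsupp.single (k : ZMod n) 1) d :=
  lt_of_apply_zero _ (by simp) (by simp [natCast_ne_zero' h1 h2]) _ _

theorem h_lt [NeZero n] {l : ℕ} (h1 : 1 ≤ l) (h2 : l + n / 2 < n) (c d : ZMod n →₀ ℕ) :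
    Finsupp.sumElim (Finsupp.single (0 : ZMod n) 1 + Finsupp.single ((n / 2 : ℕ) : ZMod n) 1) c
      ≺[productOrder (degRevLexOrder (yRank n)) m₂]
      Finsupp.sumElim (Finsupp.single (l : ZMod n) 1 +
        Finsupp.single ((l + n / 2 : ℕ) : ZMod n) 1) d := by
  refine lt_of_apply_zero _ (by simp) ?_ _ _
  have h3 := natCast_ne_zero' h1 (by omega : l < n)
  have h4 := natCast_ne_zero' (by omega) h2
  rw [Finsupp.add_apply, Finsupp.add_apply, Finsupp.single_eq_of_ne h3.symm,
    Finsupp.single_eq_of_ne h4.symm, Finsupp.single_eq_same]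
  omega

theorem sumElim_le_iff {a c : ZMod n →₀ ℕ} {v : ZMod n ⊕ ZMod n →₀ ℕ} :
    Finsupp.sumElim a c ≤ v ↔ (∀ j, a j ≤ v (Sum.inl j)) ∧ ∀ i, c i ≤ v (Sum.inr i) :=
  ⟨fun h => ⟨fun j => h (Sum.inl j), fun i => h (Sum.inr i)⟩,
    fun h z => by rcases z with z | z; exacts [h.1 z, h.2 z]⟩

theorem single_le_of_ne_zero {F : ZMod n → ℕ} {j : ZMod n} (h : F j ≠ 0) (z : ZMod n) :
    Finsupp.single j 1 z ≤ F z := by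
  classical
  rw [Finsupp.single_apply]
  split_ifs with hz
  · subst hz; omega
  · omega

theorem sum_single_le {ι : Type*} {s : Finset ι} {e : ι → ZMod n} (he : Set.InjOn e s)
    {F : ZMod n → ℕ} (h : ∀ i ∈ s, F (e i) ≠ 0) (z : ZMod n) :
    (∑ i ∈ s, Finsupp.single (e i) 1) z ≤ F z := by
  classical
  rw [Finsupp.finsetSum_apply]
  by_cases hz : ∃ i ∈ s, e i = z
  · obtain ⟨i, hi, rfl⟩ := hz
    rw [Finset.sum_eq_single i, Finsupp.single_eq_same]
    · exact Nat.one_le_iff_ne_zero.2 (h i hi)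
    · intro j hj hji
      exact Finsupp.single_eq_of_ne fun h => hji (he hj hi h.symm)
    · exact fun h => absurd hi h
  · rw [Finset.sum_eq_zero]
    · exact Nat.zero_le _
    · intro i hi
      exact Finsupp.single_eq_of_ne fun h => hz ⟨i, hi, h.symm⟩

theorem degree_f [NeZero n] {j : ℕ} (h1 : 1 ≤ j) (h2 : j < n) :
    (productOrder (degRevLexOrder (yRank n)) m₂).degree (f K n j) =
      Finsupp.sumElim (Finsupp.single (j : ZMod n) 1)
        (Finsupp.single ((n / 2 + j : ℕ) : ZMod n) 1) := by
  rw [f_eq]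
  exact degree_binomial _ (f_lt m₂ h1 h2 _ _)

theorem degree_g [NeZero n] {k : ℕ} (h1 : 1 ≤ k) (h2 : k < n) :
    (productOrder (degRevLexOrder (yRank n)) m₂).degree (g K n k) =
      Finsupp.sumElim (Finsupp.single (k : ZMod n) 1)
        (∑ i ∈ Finset.range k, Finsupp.single (i : ZMod n) 1) := by
  rw [g_eq]
  exact degree_binomial _ (g_lt m₂ h1 h2 _ _)

theorem degree_h [NeZero n] {l : ℕ} (h1 : 1 ≤ l) (h2 : l + n / 2 < n) :
    (productOrder (degRevLexOrder (yRank n)) m₂).degree (h K n l) =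
      Finsupp.sumElim (Finsupp.single (l : ZMod n) 1 +
        Finsupp.single ((l + n / 2 : ℕ) : ZMod n) 1) 0 := by
  rw [h_eq]
  exact degree_binomial _ (h_lt m₂ h1 h2 _ _)

theorem isStandard_of_not_degree_le [NeZero n] {m : ℕ} (hm : 2 ≤ m) (hn : n = m + m)
    {v : ZMod n ⊕ ZMod n →₀ ℕ}
    (hv : ∀ p ∈ f K n '' Set.Icc 1 (n - 1) ∪ g K n '' Set.Icc 1 (n / 2 - 1) ∪
      h K n '' Set.Icc 1 (n / 2 - 1),
      ¬ (productOrder (degRevLexOrder (yRank n)) m₂).degree p ≤ v) :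
    IsStandard m (fun i => v (Sum.inr (i : ZMod n))) fun j => v (Sum.inl (j : ZMod n)) := by
  have hn2 : n / 2 = m := by omega
  have hf (j : ℕ) (h1 : 1 ≤ j) (h2 : j < n) :
      v (Sum.inl (j : ZMod n)) = 0 ∨ v (Sum.inr ((m + j : ℕ) : ZMod n)) = 0 := by
    by_contra! hne
    refine hv _ (Or.inl (Or.inl ⟨j, ⟨h1, by omega⟩, rfl⟩)) ?_
    rw [degree_f K m₂ h1 h2, sumElim_le_iff, hn2]
    exact ⟨single_le_of_ne_zero (F := fun z => v (Sum.inl z)) hne.1,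
      single_le_of_ne_zero (F := fun z => v (Sum.inr z)) hne.2⟩
  have hwrap (i : ℕ) : ((m + (i + m) : ℕ) : ZMod n) = i := by
    rw [show m + (i + m) = i + n by omega, Nat.cast_add, ZMod.natCast_self, add_zero]
  refine ⟨?_, ?_, ?_, ?_, ?_⟩
  · intro l h1 h2
    simpa only [add_comm m] using hf l h1 (by omega)
  · have h1 := hf (0 + m) (by omega) (by omega)
    rw [hwrap] at h1
    simpa using h1
  · intro l h1 h2
    simpa only [hwrap] using hf (l + m) (by omega) (by omega)
  · intro k h1 h2
    by_contra! hne
    refine hv _ (Or.inl (Or.inr ⟨k, ⟨h1, by omega⟩, rfl⟩)) ?_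
    rw [degree_g K m₂ h1 (by omega), sumElim_le_iff]
    refine ⟨single_le_of_ne_zero (F := fun z => v (Sum.inl z)) hne.1,
      sum_single_le ?_ (F := fun z => v (Sum.inr z))
        fun i hi => hne.2 i (Finset.mem_range.1 hi)⟩
    intro i hi j hj hij
    rw [Finset.mem_coe, Finset.mem_range] at hi hj
    exact ZMod.natCast_injOn (by omega) (by omega) hij
  · intro l h1 h2
    by_contra! hne
    refine hv _ (Or.inr ⟨l, ⟨h1, by omega⟩, rfl⟩) ?_
    rw [degree_h K m₂ h1 (by omega), sumElim_le_iff, hn2]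
    refine ⟨fun z => ?_, fun z => Nat.zero_le _⟩
    have hlm := natCast_ne_natCast (by omega : l < n) (by omega : l + m < n) (by omega)
    have h3 := sum_single_le (s := Finset.univ) (e := ![(l : ZMod n), ((l + m : ℕ) : ZMod n)])
      (F := fun z => v (Sum.inl z)) ?_ ?_ z
    · simpa [Fin.sum_univ_two] using h3
    · rw [Finset.coe_univ, Set.injOn_univ]
      intro i j hij
      fin_cases i <;> fin_cases j <;> first | rfl | exact absurd hij hlm | exact absurd hij hlm.symm
    · intro i _
      fin_cases i
      exacts [hne.1, hne.2]

end CyclePath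

end

theorem mainTheorem10 {K : Type*} [Field K] (n : ℕ) [NeZero n] (hn : Even n) (hn4 : 4 ≤ n)
    (m₂ : MonomialOrder (ZMod n)) :
    IsGroebnerBasis (productOrder (degRevLexOrder (CyclePath.yRank n)) m₂)
      (CyclePath.f K n '' Set.Icc 1 (n - 1) ∪ CyclePath.g K n '' Set.Icc 1 (n / 2 - 1) ∪
        CyclePath.h K n '' Set.Icc 1 (n / 2 - 1))
      (CyclePath.symIdeal K n (n / 2) ⊔
        (CyclePath.fiberIdeal K n (n / 2)).map (CyclePath.inclR K n)) := by
  open CyclePath MvPolynomial in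
  have hne {v w : ZMod n ⊕ ZMod n →₀ ℕ}
      (h : w ≺[productOrder (degRevLexOrder (yRank n)) m₂] v) :
      monomial v (1 : K) - monomial w 1 ≠ 0 :=
    binomial_ne_zero (ne_of_apply_ne _ h.ne)
  obtain ⟨m, hm⟩ := id hn
  have hm2 : n / 2 = m := by omega
  refine IsGroebnerBasis.of_reduced_eq_zero _ ?_ ?_ ?_
  · exact (((Set.finite_Icc _ _).image _).union ((Set.finite_Icc _ _).image _)).union
      ((Set.finite_Icc _ _).image _)
  · rintro p ((⟨j, ⟨h1, h2⟩, rfl⟩ | ⟨k, ⟨h1, h2⟩, rfl⟩) | ⟨l, ⟨h1, h2⟩, rfl⟩)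
    · refine ⟨Ideal.mem_sup_left (CyclePath.f_mem K n j), ?_⟩
      rw [CyclePath.f_eq]
      exact hne (CyclePath.f_lt m₂ h1 (by omega) _ _)
    · refine ⟨Ideal.mem_sup_left (CyclePath.g_mem K n k), ?_⟩
      rw [CyclePath.g_eq]
      exact hne (CyclePath.g_lt m₂ h1 (by omega) _ _)
    · refine ⟨Ideal.mem_sup_right (CyclePath.h_mem K n hn l), ?_⟩
      rw [CyclePath.h_eq]
      exact hne (CyclePath.h_lt m₂ h1 (by omega) _ _)
  · intro r hr hred
    refine MvPolynomial.eq_zero_of_aeval_monomial_family_eq_zero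
      (CyclePath.reesExponent n (n / 2)) r ?_ (CyclePath.toRees_eq_zero K n _ hr)
    intro v hv w hw h
    rw [hm2] at h
    exact CyclePath.eq_of_isStandard (by omega) hm
      (CyclePath.isStandard_of_not_degree_le K m₂ (by omega) hm (hred v hv))
      (CyclePath.isStandard_of_not_degree_le K m₂ (by omega) hm (hred w hw)) h
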